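/- Let $c>0$, $\alpha\in(0,2]$, $\beta\in[-1,1]$, and set, for $\xi\in\mathbb{R}$, $$\eta_{c,\alpha,\beta}(\mathrm{i}\xi)=-|c\xi|^\alpha\bigl(1-\mathrm{i}\beta\,h(\alpha,\xi)\,\mathrm{sgn}(\xi)\bigr),\qquad h(\alpha,\xi)=\begin{cases}\tan(\pi\alpha/2)&\text{if }\alpha\neq1,\\-\frac2\pi\log|\xi|&\text{if }\alpha=1,\end{cases}$$ with $\eta_{c,\alpha,\beta}(0)=0$. Let $\phi_{c,\alpha,\beta}$ be the stable law, that is, the probability measure on $\mathbb{R}$ with Fourier transform $\int_{\mathbb{R}}\mathrm{e}^{\mathrm{i}\xi x}\,\phi_{c,\alpha,\beta}(\mathrm{d}x)=\mathrm{e}^{\eta_{c,\alpha,\beta}(\mathrm{i}\xi)}$. Let $(X_n)_{n\in\mathbb{N}}$ be a sequence of real-valued random variables (possibly defined on different probability spaces), let $(t_n)_{n\in\mathbb{N}}$ be positive real numbers with $t_n\to+\infty$, and set $\theta_n(\xi)=\mathbb{E}[\mathrm{e}^{\mathrm{i}\xi X_n}]\,\mathrm{e}^{-t_n\eta_{c,\alpha,\beta}(\mathrm{i}\xi)}$.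 Assume that $(X_n)$ has a zone of control $[-Kt_n^\gamma,Kt_n^\gamma]$ with index $(\nu,\omega)$, where $\nu,\omega,K>0$ and $\gamma\in\mathbb{R}$. This means that there are constants $K_1,K_2>0$, independent of $n$, such that for all $n$ and all $\xi\in[-Kt_n^\gamma,Kt_n^\gamma]$, $$|\theta_n(\xi)-1|\le K_1|\xi|^\nu\exp(K_2|\xi|^\omega),$$ and such that $$\alpha\le\omega,\qquad-\frac1\alpha<\gamma\le\frac1{\omega-\alpha},\qquad 0<K\le\Bigl(\frac{c^\alpha}{2K_2}\Bigr)^{\frac1{\omega-\alpha}},$$ where, if $\omega=\alpha$, the upper bounds on $\gamma$ and on $K$ are void. Let $Y_n=X_n/t_n^{1/\alpha}$ if $\alpha\neq1$, and $Y_n=X_n/t_n-\frac{2c\beta}{\pi}\log t_n$ if $\alpha=1$. Then $\phi_{c,\alpha,\beta}$ has the continuous density $p_{c,\alpha,\beta}(y)=\frac1{2\pi}\int_{\mathbb{R}}\mathrm{e}^{\eta_{c,\alpha,\beta}(\mathrm{i}\xi)}\,\mathrm{e}^{-\mathrm{i}y\xi}\,\mathrm{d}\xi$ with respect to Lebesgue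 measure $m$, and for every $\delta\in(0,\gamma+\frac1\alpha)$, every $x\in\mathbb{R}$ and every bounded measurable set $B\subset\mathbb{R}$ with $m(\partial B)=0$ and $m(B)>0$, $$\lim_{n\to\infty}t_n^\delta\;\mathbb{P}\Bigl[Y_n-x\in\frac1{t_n^\delta}B\Bigr]=p_{c,\alpha,\beta}(x)\,m(B).$$ -/

import Mathlib

open MeasureTheory Filter Topology Set
open scoped Pointwise ENNReal

noncomputable section

namespace ModStable

/-- The function `h(α, ξ)` of the Lévy exponent of a stable law. -/
def stableH (α ξ : ℝ) : ℝ :=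
  if α = 1 then -(2 / Real.pi) * Real.log |ξ| else Real.tan (Real.pi * α / 2)

/-- The Lévy exponent on the imaginary axis:
`η_{c,α,β}(iξ) = -|cξ|^α (1 - i β h(α,ξ) sgn ξ)`. -/
def stableExponent (c α β ξ : ℝ) : ℂ :=
  -((|c * ξ| ^ α : ℝ) : ℂ) *
    (1 - Complex.I * ((β * stableH α ξ * Real.sign ξ : ℝ) : ℂ))

/-- `φ` is the stable law `φ_{c,α,β}`: the probability measure on `ℝ` whose Fourier transform is
`∫ e^{iξx} φ(dx) = e^{η_{c,α,β}(iξ)}`. -/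
structure IsStableLaw (c α β : ℝ) (φ : Measure ℝ) : Prop where
  isProbabilityMeasure : IsProbabilityMeasure φ
  fourier : ∀ ξ : ℝ, ∫ x : ℝ, Complex.exp (Complex.I * ξ * x) ∂φ
    = Complex.exp (stableExponent c α β ξ)

/-- `p` is the continuous version of the density of `φ` with respect to Lebesgue measure. -/
structure IsContinuousDensity (p : ℝ → ℝ) (φ : Measure ℝ) : Prop where
  continuous : Continuous p
  nonneg : ∀ x, 0 ≤ p x
  eq_withDensity : φ = volume.withDensity (fun x => ENNReal.ofReal (p x))

/-- The function `p_{c,α,β}(y) = (1/2π) ∫ e^{η_{c,α,β}(iξ)} e^{-iyξ} dξ` given by Fourier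
inversion (the integral is real). -/
def stableDensity (c α β y : ℝ) : ℝ :=
  1 / (2 * Real.pi) *
    (∫ ξ : ℝ, Complex.exp (stableExponent c α β ξ) * Complex.exp (-(Complex.I * y * ξ))).re

/-- The residue `θ(ξ) = E[e^{iξX}] e^{-t η_{c,α,β}(iξ)}` of a random variable `X`. -/
def residue {Ω : Type*} [MeasurableSpace Ω] (P : Measure Ω) (X : Ω → ℝ) (c α β t ξ : ℝ) : ℂ :=
  (∫ w, Complex.exp (Complex.I * ξ * X w) ∂P) * Complex.exp (-((t : ℂ) * stableExponent c α β ξ))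

/-- The sequence `(X n)`, with parameters `(t n)` and reference law `φ_{c,α,β}`, has the zone of
control `[-K (t n)^γ, K (t n)^γ]` with index of control `(ν, ω)`.

When `ω = α` the upper bounds `1 / (ω - α)` and `(c^α / (2 K₂))^{1 / (ω - α)}` are not defined, and
no upper bound is put on `γ` and on `K` in that case; this is the weakest possible reading. -/
def HasZoneOfControl {Ω : ℕ → Type*} [∀ n, MeasurableSpace (Ω n)] (P : ∀ n, Measure (Ω n))
    (X : ∀ n, Ω n → ℝ) (t : ℕ → ℝ) (c α β K γ ν ω : ℝ) : Prop :=
  0 < ν ∧ 0 < ω ∧ 0 < K ∧ α ≤ ω ∧ -(1 / α) < γ ∧ (α < ω → γ ≤ 1 / (ω - α)) ∧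
  ∃ K₁ K₂ : ℝ, 0 < K₁ ∧ 0 < K₂ ∧
    (α < ω → K ≤ (c ^ α / (2 * K₂)) ^ (1 / (ω - α))) ∧
    ∀ n : ℕ, ∀ ξ ∈ Icc (-(K * t n ^ γ)) (K * t n ^ γ),
      ‖residue (P n) (X n) c α β (t n) ξ - 1‖ ≤ K₁ * |ξ| ^ ν * Real.exp (K₂ * |ξ| ^ ω)

/-- The renormalisation `Y` of `X`: `X / t^{1/α}` if `α ≠ 1`, and
`X / t - (2cβ/π) log t` if `α = 1`. -/
def renormalise {Ω : Type*} (X : Ω → ℝ) (c α β t : ℝ) (w : Ω) : ℝ :=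
  if α = 1 then X w / t - 2 * c * β / Real.pi * Real.log t else X w / t ^ (1 / α)

/-- Jordan measurable subsets of `ℝ`: bounded, measurable, with Lebesgue-null boundary. -/
structure IsJordanMeasurable (B : Set ℝ) : Prop where
  isBounded : Bornology.IsBounded B
  measurableSet : MeasurableSet B
  volume_frontier : volume (frontier B) = 0

end ModStable

end

/-!
A local limit theorem for mod-stable convergence, by Fourier analysis.

Write `η` for the exponent of the stable law and `Y n` for the renormalised variables. The exponent
is homogeneous up to a drift (`mul_stableExponent_div`), so the characteristic function of `Y n` at
`ξ` is `exp (η ξ)` times the residue at `ξ / (t n)^{1/α}`. The bounds on `γ` and `K` say that on the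
rescaled zone `|ξ| ≤ K (t n)^{γ + 1/α}` the growth `exp (K₂ |·|^ω)` of the residue costs at most half
of the decay of `exp (η ξ)` (`exp_rescaled_le`). Hence the characteristic functions converge
pointwise to `exp ∘ η` and are dominated by an integrable function on every interval
`|ξ| ≤ C (t n)^δ`, `δ < γ + 1/α` (`HasZoneOfControl.charFunControl`).

This is enough to pass to the limit against test functions whose Fourier transform has compact
support. With `s n = (t n)^δ`, let `m n` be the law of `s n * (Y n - x)` multiplied by `s n`. The
Fejér kernel `k` is nonnegative, and all its modulations are band-limited, so that the
characteristic functions of the finite measures `k(ε ·) m n` converge to that of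
`p(x) k(ε ·) dy` (`tendsto_integral_fejer_mul_exp`). Lévy's continuity theorem turns this into
convergence on Jordan measurable sets, and since `k(ε ·)` is uniformly close to `1` on a bounded set
when `ε` is small, the weight can be removed (`CharFunControl.tendsto_measureReal`).

The same convergence shows that the inverse Fourier transform `p` of `exp ∘ η` is nonnegative, being
a limit of integrals of `k`. A nonnegative Fourier transform is integrable, by Fatou's lemma
(`integrable_fhat_of_nonneg`), and Fourier inversion then makes `p` the density of the stable law
(`exists_isStableLaw`). In particular the existence of the stable law is a consequence of the
existence of a sequence with a zone of control, with no appeal to infinite divisibility.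
-/

noncomputable section

namespace ModStable

/-! ### The Fejér kernel -/

/-- The tent function, a band-limiting profile: its Fourier transform is `fejer`. -/
def tent (v : ℝ) : ℝ := max 0 (1 - |v|)

/-- The Fejér kernel `(sin (u/2) / (u/2))²`, a nonnegative integrable function whose Fourier
transform is supported in `[-1, 1]`. -/
def fejer (u : ℝ) : ℝ := Real.sinc (u / 2) ^ 2

lemma continuous_tent : Continuous tent := by unfold tent; fun_prop

lemma tent_nonneg (v : ℝ) : 0 ≤ tent v := le_max_left _ _

lemma tent_le_one (v : ℝ) : tent v ≤ 1 := max_le zero_le_one (by linarith [abs_nonneg v])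

lemma tent_zero : tent 0 = 1 := by simp [tent]

lemma tent_neg (v : ℝ) : tent (-v) = tent v := by simp [tent]

lemma tent_eq_zero {v : ℝ} (hv : 1 ≤ |v|) : tent v = 0 := max_eq_left (by linarith)

lemma integrable_tent : Integrable tent :=
  continuous_tent.integrable_of_hasCompactSupport
    (HasCompactSupport.of_support_subset_isCompact (isCompact_Icc (a := -1) (b := 1)) (by
      intro v hv
      by_contra h
      refine hv (tent_eq_zero ?_)
      by_contra h'
      exact h (abs_le.1 (not_le.1 h').le)))

lemma continuous_fejer : Continuous fejer := by
  unfold fejer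
  exact (Real.continuous_sinc.comp (continuous_id.div_const 2)).pow 2

lemma fejer_nonneg (u : ℝ) : 0 ≤ fejer u := sq_nonneg _

lemma fejer_le_one (u : ℝ) : fejer u ≤ 1 := by
  have := Real.abs_sinc_le_one (u / 2)
  rw [fejer, ← sq_abs]
  exact pow_le_one₀ (abs_nonneg _) this

lemma fejer_zero : fejer 0 = 1 := by simp [fejer]

lemma fejer_neg (u : ℝ) : fejer (-u) = fejer u := by simp [fejer, neg_div]

lemma fejer_le_inv_one_add_sq (u : ℝ) : fejer u ≤ 5 * (1 + u ^ 2)⁻¹ := by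
  rw [← div_eq_mul_inv, le_div_iff₀ (by positivity)]
  have h1 := fejer_le_one u
  have h2 : fejer u * u ^ 2 ≤ 4 := by
    rcases eq_or_ne u 0 with rfl | hu
    · norm_num
    · rw [fejer, Real.sinc_of_ne_zero (by positivity)]
      have := Real.sin_sq_le_one (u / 2)
      have e : (Real.sin (u / 2) / (u / 2)) ^ 2 * u ^ 2 = 4 * Real.sin (u / 2) ^ 2 := by
        field_simp
        ring
      linarith
  linarith

lemma integrable_fejer : Integrable fejer := by
  refine (integrable_inv_one_add_sq.const_mul 5).mono' continuous_fejer.aestronglyMeasurable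
    (ae_of_all _ fun u => ?_)
  rw [Real.norm_of_nonneg (fejer_nonneg u)]
  exact fejer_le_inv_one_add_sq u

/-- The Fourier transform of the tent function is the Fejér kernel. -/
lemma integral_tent_mul_exp (u : ℝ) :
    ∫ v : ℝ, (tent v : ℂ) * Complex.exp (Complex.I * u * v) = fejer u := by
  have hsupp : Function.support (fun v : ℝ => (tent v : ℂ) * Complex.exp (Complex.I * u * v))
      ⊆ Ioc (-1) 1 := by
    intro v hv
    by_contra h
    refine hv ?_
    have : 1 ≤ |v| := by
      by_contra h'
      rw [not_le, abs_lt] at h'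
      exact h ⟨h'.1, h'.2.le⟩
    simp [tent_eq_zero this]
  have hcont : Continuous (fun v : ℝ => (tent v : ℂ) * Complex.exp (Complex.I * u * v)) := by
    have := continuous_tent
    fun_prop
  rw [← intervalIntegral.integral_eq_integral_of_support_subset hsupp,
    ← intervalIntegral.integral_add_adjacent_intervals (b := 0)
      (hcont.intervalIntegrable _ _) (hcont.intervalIntegrable _ _)]
  have eL : ∫ v in (-1 : ℝ)..0, (tent v : ℂ) * Complex.exp (Complex.I * u * v)
      = ∫ v in (-1 : ℝ)..0, (1 + v : ℂ) * Complex.exp (Complex.I * u * v) := by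
    refine intervalIntegral.integral_congr fun v hv => ?_
    rw [uIcc_of_le (by norm_num)] at hv
    have : tent v = 1 + v := by
      rw [tent, abs_of_nonpos hv.2, max_eq_right (by linarith [hv.1])]; ring
    simp [this]
  have eR : ∫ v in (0 : ℝ)..1, (tent v : ℂ) * Complex.exp (Complex.I * u * v)
      = ∫ v in (0 : ℝ)..1, (1 - v : ℂ) * Complex.exp (Complex.I * u * v) := by
    refine intervalIntegral.integral_congr fun v hv => ?_
    rw [uIcc_of_le (by norm_num)] at hv
    have : tent v = 1 - v := by
      rw [tent, abs_of_nonneg hv.1, max_eq_right (by linarith [hv.2])]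
    simp [this]
  rw [eL, eR]
  rcases eq_or_ne u 0 with rfl | hu
  · have hL : ∫ v in (-1 : ℝ)..0, (1 + v : ℂ) * Complex.exp (Complex.I * (0 : ℝ) * v)
        = ((∫ v in (-1 : ℝ)..0, (1 + v) : ℝ) : ℂ) := by
      rw [← intervalIntegral.integral_ofReal]
      simp
    have hR : ∫ v in (0 : ℝ)..1, (1 - v : ℂ) * Complex.exp (Complex.I * (0 : ℝ) * v)
        = ((∫ v in (0 : ℝ)..1, (1 - v) : ℝ) : ℂ) := by
      rw [← intervalIntegral.integral_ofReal]
      simp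
    rw [hL, hR, fejer_zero, intervalIntegral.integral_add (by simp) (by simp),
      intervalIntegral.integral_sub (by simp) (by simp)]
    norm_num
  · have hu' : (u : ℂ) ≠ 0 := by exact_mod_cast hu
    set a : ℂ := Complex.I * u with ha
    have ha0 : a ≠ 0 := mul_ne_zero Complex.I_ne_zero hu'
    have hexp : ∀ v : ℝ, HasDerivAt (fun v : ℝ => Complex.exp (a * v)) (a * Complex.exp (a * v)) v := by
      intro v
      have h1 : HasDerivAt (fun v : ℝ => a * (v : ℂ)) a v := by
        simpa using (Complex.ofRealCLM.hasDerivAt (x := v)).const_mul a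
      simpa [mul_comm] using h1.cexp
    have hid : ∀ v : ℝ, HasDerivAt (fun v : ℝ => (v : ℂ)) 1 v := fun v =>
      (hasDerivAt_id v).ofReal_comp
    have dL : ∀ v : ℝ, HasDerivAt
        (fun v : ℝ => (1 + v : ℂ) * Complex.exp (a * v) / a - Complex.exp (a * v) / a ^ 2)
        ((1 + v : ℂ) * Complex.exp (a * v)) v := by
      intro v
      refine (((((hid v).const_add 1).mul (hexp v)).div_const a).sub
        ((hexp v).div_const (a ^ 2))).congr_deriv ?_
      field_simp
      ring
    have dR : ∀ v : ℝ, HasDerivAt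
        (fun v : ℝ => (1 - v : ℂ) * Complex.exp (a * v) / a + Complex.exp (a * v) / a ^ 2)
        ((1 - v : ℂ) * Complex.exp (a * v)) v := by
      intro v
      refine (((((hid v).const_sub 1).mul (hexp v)).div_const a).add
        ((hexp v).div_const (a ^ 2))).congr_deriv ?_
      field_simp
      ring
    rw [intervalIntegral.integral_eq_sub_of_hasDerivAt (fun v _ => dL v)
        (Continuous.intervalIntegrable (by fun_prop) _ _),
      intervalIntegral.integral_eq_sub_of_hasDerivAt (fun v _ => dR v)
        (Continuous.intervalIntegrable (by fun_prop) _ _)]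
    have hcos : Complex.exp (a * 1) + Complex.exp (a * -1) = 2 * (Real.cos u : ℂ) := by
      rw [Complex.ofReal_cos, Complex.two_cos, ha]
      congr 2 <;> ring
    have hsin : fejer u * u ^ 2 = 2 - 2 * Real.cos u := by
      rw [fejer, Real.sinc_of_ne_zero (by positivity)]
      have h := Real.cos_sq (u / 2)
      have h' := Real.sin_sq_add_cos_sq (u / 2)
      rw [show 2 * (u / 2) = u by ring] at h
      field_simp
      linarith
    have hsin' : (fejer u : ℂ) * u ^ 2 = 2 - 2 * (Real.cos u : ℂ) := by exact_mod_cast hsin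
    have ha2 : a ^ 2 = -(u : ℂ) ^ 2 := by rw [ha, mul_pow, Complex.I_sq]; ring
    have h2 : (fejer u : ℂ) = (Complex.exp (a * 1) + Complex.exp (a * -1) - 2) / a ^ 2 := by
      rw [eq_div_iff (pow_ne_zero 2 ha0), ha2, hcos]
      linear_combination -hsin'
    rw [h2]
    push_cast
    simp only [mul_zero, Complex.exp_zero]
    field_simp
    ring

/-! ### Fourier inversion -/

/-- The Fourier transform `y ↦ ∫ f(ξ) e^{-iyξ} dξ`, without normalising constant. -/
def fhat (f : ℝ → ℂ) (y : ℝ) : ℂ := ∫ ξ : ℝ, f ξ * Complex.exp (-(Complex.I * y * ξ))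

lemma norm_exp_neg_I_mul (y ξ : ℝ) : ‖Complex.exp (-(Complex.I * y * ξ))‖ = 1 := by
  rw [show -(Complex.I * y * ξ) = ((-(y * ξ) : ℝ) : ℂ) * Complex.I by push_cast; ring]
  exact Complex.norm_exp_ofReal_mul_I _

lemma norm_exp_I_mul (y ξ : ℝ) : ‖Complex.exp (Complex.I * y * ξ)‖ = 1 := by
  rw [show (Complex.I * y * ξ) = ((y * ξ : ℝ) : ℂ) * Complex.I by push_cast; ring]
  exact Complex.norm_exp_ofReal_mul_I _

lemma continuous_fhat {f : ℝ → ℂ} (hf : Integrable f) : Continuous (fhat f) := by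
  refine continuous_of_dominated (bound := fun ξ => ‖f ξ‖) (fun y => ?_) (fun y => ?_) hf.norm ?_
  · exact hf.aestronglyMeasurable.mul (Continuous.aestronglyMeasurable (by fun_prop))
  · exact ae_of_all _ fun ξ => by rw [norm_mul, norm_exp_neg_I_mul, mul_one]
  · exact ae_of_all _ fun ξ => by fun_prop

lemma fhat_eq_fourier (f : ℝ → ℂ) (y : ℝ) :
    fhat f y = FourierTransform.fourier f (y / (2 * Real.pi)) := by
  rw [fhat, Real.fourier_real_eq_integral_exp_smul]
  refine integral_congr_ae (ae_of_all _ fun ξ => ?_)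
  have : (Real.pi : ℂ) ≠ 0 := by exact_mod_cast Real.pi_ne_zero
  simp only [smul_eq_mul]
  rw [mul_comm]
  congr 2
  push_cast
  field_simp

/-- Fourier inversion for `fhat`. -/
lemma integral_fhat_mul_exp {f : ℝ → ℂ} (hc : Continuous f) (hf : Integrable f)
    (hi : Integrable (fhat f)) (ξ : ℝ) :
    ∫ y : ℝ, fhat f y * Complex.exp (Complex.I * ξ * y) = 2 * Real.pi * f ξ := by
  have hpi : (2 * Real.pi) ≠ 0 := by positivity
  have hF : Integrable (FourierTransform.fourier f) := by
    have := hi.comp_mul_left' hpi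
    refine this.congr (ae_of_all _ fun y => ?_)
    simp only [fhat_eq_fourier]
    field_simp
  have h := congrFun (hc.fourierInv_fourier_eq hf hF) ξ
  rw [Real.fourierInv_eq'] at h
  rw [← h]
  have h2 := Measure.integral_comp_div
    (fun v : ℝ => Complex.exp (((2 * Real.pi * inner ℝ v ξ : ℝ) : ℂ) * Complex.I)
      • FourierTransform.fourier f v) (2 * Real.pi)
  rw [abs_of_pos (by positivity)] at h2
  rw [show (2 * Real.pi : ℂ) = ((2 * Real.pi : ℝ) : ℂ) by push_cast; ring, ← Complex.real_smul, ← h2]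
  refine integral_congr_ae (ae_of_all _ fun y => ?_)
  simp only [fhat_eq_fourier, smul_eq_mul]
  rw [mul_comm]
  congr 2
  have : (Real.pi : ℂ) ≠ 0 := by exact_mod_cast Real.pi_ne_zero
  have hinner : inner ℝ (y / (2 * Real.pi)) ξ = y / (2 * Real.pi) * ξ := by simp [mul_comm]
  rw [hinner]
  push_cast
  field_simp

lemma fhat_tent (y : ℝ) : fhat (fun v => (tent v : ℂ)) y = fejer y := by
  rw [fhat, ← fejer_neg, ← integral_tent_mul_exp]
  refine integral_congr_ae (ae_of_all _ fun ξ => ?_)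
  simp

lemma integral_fejer_mul_exp (ξ : ℝ) :
    ∫ y : ℝ, (fejer y : ℂ) * Complex.exp (Complex.I * ξ * y) = 2 * Real.pi * tent ξ := by
  have h : fhat (fun v => (tent v : ℂ)) = fun y => (fejer y : ℂ) := funext fhat_tent
  have := integral_fhat_mul_exp (f := fun v => (tent v : ℂ))
    (Complex.continuous_ofReal.comp continuous_tent) integrable_tent.ofReal
    (by rw [h]; exact integrable_fejer.ofReal) ξ
  rwa [h] at this

/-- The Fourier transform of the dilated kernel `fejer (ε ·)`. -/
lemma integral_fejer_dilated_mul_exp {ε : ℝ} (hε : 0 < ε) (ξ : ℝ) :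
    ∫ y : ℝ, (fejer (ε * y) : ℂ) * Complex.exp (Complex.I * ξ * y)
      = 2 * Real.pi / ε * tent (ξ / ε) := by
  have h := Measure.integral_comp_mul_left
    (fun y : ℝ => (fejer y : ℂ) * Complex.exp (Complex.I * ((ξ / ε : ℝ) : ℂ) * y)) ε
  rw [integral_fejer_mul_exp, abs_of_pos (inv_pos.2 hε), Complex.real_smul] at h
  have hε' : (ε : ℂ) ≠ 0 := by exact_mod_cast hε.ne'
  rw [show (2 * Real.pi / ε * tent (ξ / ε) : ℂ)
    = ((ε⁻¹ : ℝ) : ℂ) * (2 * Real.pi * tent (ξ / ε)) by push_cast; ring, ← h]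
  refine integral_congr_ae (ae_of_all _ fun y => ?_)
  simp only
  congr 2
  push_cast
  field_simp

/-- Fubini's theorem for the kernel `e^{iyξ}`. -/
lemma integral_mul_integral_mul_exp {μ : Measure ℝ} [SFinite μ] {a b : ℝ → ℂ}
    (ha : Integrable a μ) (hb : Integrable b) :
    ∫ y, a y * ∫ ξ, b ξ * Complex.exp (Complex.I * ξ * y) ∂volume ∂μ
      = ∫ ξ, b ξ * ∫ y, a y * Complex.exp (Complex.I * ξ * y) ∂μ := by
  have h : Integrable (Function.uncurry fun y ξ : ℝ =>
      a y * (b ξ * Complex.exp (Complex.I * ξ * y))) (μ.prod volume) := by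
    refine (ha.mul_prod hb).mono ?_ (ae_of_all _ fun z => ?_)
    · have h1 : AEStronglyMeasurable (fun z : ℝ × ℝ => a z.1 * b z.2) (μ.prod volume) :=
        (ha.mul_prod hb).aestronglyMeasurable
      have h2 : AEStronglyMeasurable
          (fun z : ℝ × ℝ => Complex.exp (Complex.I * z.2 * z.1)) (μ.prod volume) :=
        Continuous.aestronglyMeasurable (by fun_prop)
      refine (h1.mul h2).congr (ae_of_all _ fun z => ?_)
      simp [Function.uncurry, mul_assoc]
    · simp only [Function.uncurry, norm_mul, norm_exp_I_mul, mul_one, le_refl]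
  simp_rw [← integral_const_mul]
  rw [integral_integral_swap h]
  refine integral_congr_ae (ae_of_all _ fun ξ => integral_congr_ae (ae_of_all _ fun y => ?_))
  simp only
  ring

/-! ### Band-limited test functions -/

/-- Testing a probability measure against a rescaled and modulated Fejér kernel only involves its
characteristic function on a bounded interval. -/
lemma integral_fejer_mul_exp_eq_charFun (μ : Measure ℝ) [IsProbabilityMeasure μ] {s ε : ℝ}
    (hs : 0 < s) (hε : 0 < ε) (x ζ : ℝ) :
    s * ∫ y, (fejer (ε * (s * (y - x))) : ℂ) * Complex.exp (Complex.I * ζ * (s * (y - x) : ℝ)) ∂μ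
      = 1 / ε * ∫ ξ : ℝ, (tent (ξ / (ε * s) - ζ / ε) : ℂ) * Complex.exp (-(Complex.I * x * ξ))
        * charFun μ ξ := by
  have hr : 0 < ε * s := mul_pos hε hs
  have hs' : (s : ℂ) ≠ 0 := by exact_mod_cast hs.ne'
  have hε' : (ε : ℂ) ≠ 0 := by exact_mod_cast hε.ne'
  set b : ℝ → ℂ := fun ξ => (tent (ξ / (ε * s) - ζ / ε) : ℂ) * Complex.exp (-(Complex.I * x * ξ))
    with hb
  have hbi : Integrable b := by
    have h1 : Integrable (fun ξ : ℝ => tent (ξ / (ε * s) - ζ / ε)) :=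
      (integrable_tent.comp_sub_right (ζ / ε)).comp_div hr.ne'
    refine h1.norm.mono' ?_ (ae_of_all _ fun ξ => ?_)
    · have := continuous_tent
      exact Continuous.aestronglyMeasurable (by fun_prop)
    · simp only [hb, norm_mul, norm_exp_neg_I_mul, mul_one, Complex.norm_real, le_refl]
  have key : ∀ y : ℝ, (fejer (ε * (s * (y - x))) : ℂ)
      * Complex.exp (Complex.I * ζ * (s * (y - x) : ℝ))
      = 1 / (ε * s) * ∫ ξ, b ξ * Complex.exp (Complex.I * ξ * y) := by
    intro y
    rw [← integral_tent_mul_exp, ← integral_mul_const]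
    have h1 := Measure.integral_comp_div (fun v : ℝ => b (ε * s * v)
      * Complex.exp (Complex.I * (ε * s * v : ℝ) * y)) (ε * s)
    rw [abs_of_pos hr] at h1
    have h2 := integral_sub_right_eq_self (μ := volume) (fun v : ℝ => (tent v : ℂ)
      * Complex.exp (Complex.I * (ε * (s * (y - x)) : ℝ) * v)
      * Complex.exp (Complex.I * ζ * (s * (y - x) : ℝ))) (ζ / ε)
    have h3 : ∫ ξ, b ξ * Complex.exp (Complex.I * ξ * y)
        = ∫ ξ : ℝ, b (ε * s * (ξ / (ε * s)))
          * Complex.exp (Complex.I * (ε * s * (ξ / (ε * s)) : ℝ) * y) := by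
      simp_rw [mul_div_cancel₀ _ hr.ne']
    rw [h3, h1, ← h2, Complex.real_smul, ← mul_assoc (1 / (ε * s : ℂ))]
    have h4 : (1 / (ε * s) * ((ε * s : ℝ) : ℂ) : ℂ) = 1 := by
      push_cast
      field_simp
    rw [h4, one_mul]
    refine integral_congr_ae (ae_of_all _ fun v => ?_)
    simp only [hb]
    rw [mul_div_cancel_left₀ _ hr.ne', mul_assoc (tent (v - ζ / ε) : ℂ),
      mul_assoc (tent (v - ζ / ε) : ℂ), ← Complex.exp_add, ← Complex.exp_add]
    congr 2
    push_cast
    field_simp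
    ring
  simp_rw [key]
  have hF := integral_mul_integral_mul_exp (μ := μ) (a := fun _ => 1) (integrable_const _) hbi
  simp only [one_mul] at hF
  rw [integral_const_mul, hF]
  have : ∀ ξ : ℝ, ∫ y : ℝ, Complex.exp (Complex.I * ξ * y) ∂μ = charFun μ ξ := by
    intro ξ
    rw [charFun_apply_real]
    refine integral_congr_ae (ae_of_all _ fun y => ?_)
    simp only
    congr 1
    ring
  simp_rw [this]
  rw [← mul_assoc]
  congr 1
  field_simp

/-- The control on characteristic functions behind the local limit theorem at scale `1 / s n`: the
characteristic functions converge pointwise to `f`, and on each interval `[-C s n, C s n]` they are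
eventually dominated by a fixed integrable function. -/
structure CharFunControl (μ : ℕ → Measure ℝ) (s : ℕ → ℝ) (f : ℝ → ℂ) : Prop where
  tendsto : ∀ ξ, Tendsto (fun n => charFun (μ n) ξ) atTop (𝓝 (f ξ))
  dominated : ∃ g : ℝ → ℝ, Integrable g ∧
    ∀ C : ℝ, ∀ᶠ n in atTop, ∀ ξ : ℝ, |ξ| ≤ C * s n → ‖charFun (μ n) ξ‖ ≤ g ξ

/-- The local limit theorem for modulated Fejér kernels. -/
lemma tendsto_integral_fejer_mul_exp {μ : ℕ → Measure ℝ} [∀ n, IsProbabilityMeasure (μ n)]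
    {s : ℕ → ℝ} {f : ℝ → ℂ} (h : CharFunControl μ s f) (hs0 : ∀ n, 0 < s n)
    (hs : Tendsto s atTop atTop) {ε : ℝ} (hε : 0 < ε) (x ζ : ℝ) :
    Tendsto (fun n => (s n : ℂ) * ∫ y, (fejer (ε * (s n * (y - x))) : ℂ)
      * Complex.exp (Complex.I * ζ * (s n * (y - x) : ℝ)) ∂(μ n)) atTop
      (𝓝 (1 / ε * (tent (ζ / ε) * fhat f x))) := by
  simp_rw [fun n => integral_fejer_mul_exp_eq_charFun (μ n) (hs0 n) hε x ζ]
  refine Tendsto.const_mul _ ?_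
  rw [fhat, ← integral_const_mul]
  obtain ⟨g, hg, hdom⟩ := h.dominated
  have hr : ∀ n, 0 < ε * s n := fun n => mul_pos hε (hs0 n)
  refine tendsto_integral_filter_of_dominated_convergence (fun ξ => |g ξ|) ?_ ?_ hg.abs ?_
  · refine Eventually.of_forall fun n => Continuous.aestronglyMeasurable ?_
    have h1 := continuous_tent
    have h2 : Continuous (charFun (μ n)) := continuous_charFun
    fun_prop
  · filter_upwards [hdom (ε * (1 + |ζ / ε|))] with n hn
    refine ae_of_all _ fun ξ => ?_
    rw [norm_mul, norm_mul, norm_exp_neg_I_mul, mul_one, Complex.norm_real,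
      Real.norm_of_nonneg (tent_nonneg _)]
    by_cases hξ : |ξ| ≤ ε * (1 + |ζ / ε|) * s n
    · exact (mul_le_of_le_one_left (norm_nonneg _) (tent_le_one _)).trans
        ((hn ξ hξ).trans (le_abs_self _))
    · have h1 : 1 ≤ |ξ / (ε * s n) - ζ / ε| := by
        refine le_trans ?_ (abs_sub_abs_le_abs_sub _ _)
        rw [abs_div, abs_of_pos (hr n), le_sub_iff_add_le, le_div_iff₀ (hr n)]
        linarith
      rw [tent_eq_zero h1, zero_mul]
      exact abs_nonneg _
  · refine ae_of_all _ fun ξ => ?_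
    have h1 : Tendsto (fun n => ξ / (ε * s n) - ζ / ε) atTop (𝓝 (0 - ζ / ε)) :=
      (Tendsto.div_atTop tendsto_const_nhds (hs.const_mul_atTop hε)).sub_const _
    have h2 : Tendsto (fun n => (tent (ξ / (ε * s n) - ζ / ε) : ℂ)) atTop
        (𝓝 (tent (ζ / ε) : ℂ)) := by
      have := (continuous_tent.tendsto _).comp h1
      rw [zero_sub, tent_neg] at this
      exact (Complex.continuous_ofReal.tendsto _).comp this
    have := (h2.mul_const (Complex.exp (-(Complex.I * x * ξ)))).mul (h.tendsto ξ)
    convert this using 2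
    ring

/-! ### Lévy's continuity theorem for finite measures -/

lemma charFun_zero_eq_measureReal (μ : Measure ℝ) : charFun μ 0 = (μ.real univ : ℂ) := by
  simp

/-- Convergence of characteristic functions of finite measures, mass not being prescribed, gives
convergence of the measures of sets with null boundary. -/
lemma tendsto_measureReal_of_tendsto_charFun {μ : ℕ → Measure ℝ} {ρ : Measure ℝ}
    [∀ n, IsFiniteMeasure (μ n)] [IsFiniteMeasure ρ]
    (h : ∀ ζ, Tendsto (fun n => charFun (μ n) ζ) atTop (𝓝 (charFun ρ ζ)))
    {A : Set ℝ} (hA : ρ (frontier A) = 0) :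
    Tendsto (fun n => (μ n).real A) atTop (𝓝 (ρ.real A)) := by
  have hmass : Tendsto (fun n => (μ n).real univ) atTop (𝓝 (ρ.real univ)) := by
    have := (Complex.continuous_re.tendsto _).comp (h 0)
    simpa [Function.comp_def, charFun_zero_eq_measureReal] using this
  rcases eq_or_ne (ρ.real univ) 0 with h0 | h0
  · have hρA : ρ.real A = 0 :=
      le_antisymm ((measureReal_mono (subset_univ A)).trans h0.le) measureReal_nonneg
    rw [hρA]
    rw [h0] at hmass
    exact squeeze_zero (fun _ => measureReal_nonneg)
      (fun n => measureReal_mono (subset_univ A)) hmass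
  -- the masses are eventually nonzero: normalise, with `ρ` in place of the vanishing terms
  let N : Measure ℝ → Measure ℝ := fun m => (ENNReal.ofReal (m.real univ)⁻¹) • m
  have hNprob : ∀ m : Measure ℝ, IsFiniteMeasure m → m.real univ ≠ 0 →
      IsProbabilityMeasure (N m) := by
    intro m _ hm
    have hm' : 0 < m.real univ := lt_of_le_of_ne measureReal_nonneg hm.symm
    refine ⟨?_⟩
    simp only [N, Measure.smul_apply, smul_eq_mul]
    rw [← ofReal_measureReal (μ := m) (s := univ), ← ENNReal.ofReal_mul (inv_nonneg.2 hm'.le),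
      inv_mul_cancel₀ hm, ENNReal.ofReal_one]
  have hNcf : ∀ (m : Measure ℝ) (ζ : ℝ), charFun (N m) ζ = ((m.real univ)⁻¹ : ℝ) * charFun m ζ := by
    intro m ζ
    simp only [charFun_apply_real, N]
    rw [integral_smul_measure, ENNReal.toReal_ofReal (inv_nonneg.2 measureReal_nonneg),
      Complex.real_smul]
  have hNreal : ∀ (m : Measure ℝ), (N m).real A = (m.real univ)⁻¹ * m.real A := by
    intro m
    simp only [N, measureReal_ennreal_smul_apply,
      ENNReal.toReal_ofReal (inv_nonneg.2 measureReal_nonneg)]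
  let M : ℕ → Measure ℝ := fun n => if (μ n).real univ = 0 then N ρ else N (μ n)
  have hM : ∀ n, IsProbabilityMeasure (M n) := by
    intro n
    by_cases hn : (μ n).real univ = 0
    · simpa only [M, if_pos hn] using hNprob ρ inferInstance h0
    · simpa only [M, if_neg hn] using hNprob (μ n) inferInstance hn
  have hMev : ∀ᶠ n in atTop, M n = N (μ n) := by
    filter_upwards [hmass.eventually_ne h0] with n hn
    simp only [M, if_neg hn]
  have hinv := hmass.inv₀ h0
  let MP : ℕ → ProbabilityMeasure ℝ := fun n => ⟨M n, hM n⟩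
  let NP : ProbabilityMeasure ℝ := ⟨N ρ, hNprob ρ inferInstance h0⟩
  have hlim : Tendsto MP atTop (𝓝 NP) := by
    rw [ProbabilityMeasure.tendsto_iff_tendsto_charFun]
    intro ζ
    simp only [MP, NP, ProbabilityMeasure.coe_mk]
    rw [hNcf]
    refine Tendsto.congr' (hMev.mono fun n hn => ?_)
      (((Complex.continuous_ofReal.tendsto _).comp hinv).mul (h ζ))
    simp only [Function.comp_apply]
    rw [hn, hNcf]
  have hset := ProbabilityMeasure.tendsto_measure_of_null_frontier_of_tendsto' hlim (E := A) (by
    simp [NP, N, hA])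
  have hset' : Tendsto (fun n => (M n).real A) atTop (𝓝 ((N ρ).real A)) :=
    (ENNReal.tendsto_toReal (by
      have := hNprob ρ inferInstance h0
      exact measure_ne_top (N ρ) A)).comp hset
  rw [hNreal] at hset'
  have hmul := hmass.mul hset'
  rw [mul_inv_cancel_left₀ h0] at hmul
  refine Tendsto.congr' ?_ hmul
  filter_upwards [hMev, hmass.eventually_ne h0] with n hn hn0
  rw [hn, hNreal, mul_inv_cancel_left₀ hn0]

/-! ### The local limit theorem under control of the characteristic functions -/

lemma measureReal_withDensity_bounds {m : Measure ℝ} {k : ℝ → ℝ} {A : Set ℝ} {a : ℝ}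
    (hA : MeasurableSet A) (hmA : m A ≠ ∞) (ha : 0 ≤ a) (hak : ∀ u ∈ A, a ≤ k u)
    (hk1 : ∀ u, k u ≤ 1) :
    a * m.real A ≤ (m.withDensity fun u => ENNReal.ofReal (k u)).real A ∧
      (m.withDensity fun u => ENNReal.ofReal (k u)).real A ≤ m.real A := by
  have hle : (m.withDensity fun u => ENNReal.ofReal (k u)) A ≤ m A := by
    rw [withDensity_apply _ hA]
    calc ∫⁻ u in A, ENNReal.ofReal (k u) ∂m ≤ ∫⁻ _ in A, 1 ∂m := by
          refine lintegral_mono fun u => ?_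
          exact ENNReal.ofReal_le_one.2 (hk1 u)
      _ = m A := by simp
  refine ⟨?_, ENNReal.toReal_mono hmA hle⟩
  have hge : ENNReal.ofReal a * m A ≤ (m.withDensity fun u => ENNReal.ofReal (k u)) A := by
    rw [withDensity_apply _ hA, ← setLIntegral_const]
    exact setLIntegral_mono' hA fun u hu => ENNReal.ofReal_le_ofReal (hak u hu)
  have := ENNReal.toReal_mono (ne_top_of_le_ne_top hmA hle) hge
  rwa [ENNReal.toReal_mul, ENNReal.toReal_ofReal ha] at this

lemma charFun_smul_withDensity_fejer (m : Measure ℝ) {r : ℝ} (hr : 0 ≤ r) (ε ζ : ℝ) :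
    charFun (ENNReal.ofReal r • m.withDensity fun u => ENNReal.ofReal (fejer (ε * u))) ζ
      = r * ∫ u, (fejer (ε * u) : ℂ) * Complex.exp (Complex.I * ζ * u) ∂m := by
  have hmeas : Measurable fun u => ENNReal.ofReal (fejer (ε * u)) :=
    ENNReal.measurable_ofReal.comp
      (continuous_fejer.comp (continuous_const_mul ε)).measurable
  rw [charFun_apply_real, integral_smul_measure, ENNReal.toReal_ofReal hr, Complex.real_smul,
    integral_withDensity_eq_integral_toReal_smul hmeas (ae_of_all _ fun _ => ENNReal.ofReal_lt_top)]
  congr 1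
  refine integral_congr_ae (ae_of_all _ fun u => ?_)
  simp only [ENNReal.toReal_ofReal (fejer_nonneg _), Complex.real_smul]
  congr 2
  ring

section LocalLimit

variable {μ : ℕ → Measure ℝ} [∀ n, IsProbabilityMeasure (μ n)] {s : ℕ → ℝ} {f : ℝ → ℂ}

/-- The Fourier transform of the limit is real and nonnegative, since it is a limit of integrals of
the nonnegative kernel `fejer`. -/
lemma CharFunControl.fhat_nonneg (h : CharFunControl μ s f) (hs0 : ∀ n, 0 < s n)
    (hs : Tendsto s atTop atTop) (x : ℝ) :
    0 ≤ (fhat f x).re ∧ fhat f x = ((fhat f x).re : ℂ) := by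
  have hlim := tendsto_integral_fejer_mul_exp h hs0 hs one_pos x 0
  simp only [Complex.ofReal_zero, mul_zero, zero_mul, Complex.exp_zero, mul_one, tent_zero,
    Complex.ofReal_one, div_one, one_mul] at hlim
  have hreal : ∀ n, (s n : ℂ) * ∫ y, (fejer (s n * (y - x)) : ℂ) ∂(μ n)
      = ((s n * ∫ y, fejer (s n * (y - x)) ∂(μ n) : ℝ) : ℂ) := by
    intro n
    rw [integral_complex_ofReal]
    push_cast
    rfl
  simp_rw [hreal] at hlim
  have hre := (Complex.continuous_re.tendsto _).comp hlim
  have him := (Complex.continuous_im.tendsto _).comp hlim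
  simp only [Function.comp_def, Complex.ofReal_re, Complex.ofReal_im] at hre him
  refine ⟨ge_of_tendsto' hre fun n => mul_nonneg (hs0 n).le (integral_nonneg fun y => ?_), ?_⟩
  · exact fejer_nonneg _
  · exact Complex.ext rfl (tendsto_nhds_unique him tendsto_const_nhds)

/-- Local limit theorem at scale `1 / s n` under control of the characteristic functions. -/
theorem CharFunControl.tendsto_measureReal (h : CharFunControl μ s f) (hs0 : ∀ n, 0 < s n)
    (hs : Tendsto s atTop atTop) (x : ℝ) {B : Set ℝ} (hB : IsJordanMeasurable B) :
    Tendsto (fun n => s n * (μ n).real {y | s n * (y - x) ∈ B}) atTop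
      (𝓝 ((fhat f x).re / (2 * Real.pi) * volume.real B)) := by
  obtain ⟨hp0, hpr⟩ := h.fhat_nonneg hs0 hs x
  set p : ℝ := (fhat f x).re / (2 * Real.pi) with hp
  have hp_nonneg : 0 ≤ p := by positivity
  have hfhat : fhat f x = 2 * Real.pi * p := by
    rw [hpr, hp]
    have : (Real.pi : ℂ) ≠ 0 := by exact_mod_cast Real.pi_ne_zero
    push_cast
    field_simp
  have hBfin : volume B ≠ ∞ := hB.isBounded.measure_lt_top.ne
  have hφ : ∀ n, Measurable fun y : ℝ => s n * (y - x) := fun n => by fun_prop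
  let lam : ℕ → Measure ℝ := fun n => (μ n).map fun y => s n * (y - x)
  have hlam : ∀ n, IsProbabilityMeasure (lam n) := fun n =>
    Measure.isProbabilityMeasure_map (hφ n).aemeasurable
  have hlamB : ∀ n, (lam n).real B = (μ n).real {y | s n * (y - x) ∈ B} := fun n =>
    map_measureReal_apply (hφ n) hB.measurableSet
  simp_rw [← hlamB]
  -- the same limit, with the measures weighted by a dilated Fejér kernel
  have hker : ∀ ε : ℝ, 0 < ε → Tendsto (fun n => s n *
      ((lam n).withDensity fun u => ENNReal.ofReal (fejer (ε * u))).real B) atTop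
      (𝓝 (p * (volume.withDensity fun u => ENNReal.ofReal (fejer (ε * u))).real B)) := by
    intro ε hε
    have hfinw : ∀ m : Measure ℝ, IsFiniteMeasure m →
        IsFiniteMeasure (m.withDensity fun u => ENNReal.ofReal (fejer (ε * u))) := by
      intro m _
      refine isFiniteMeasure_withDensity_ofReal ?_
      refine (Integrable.of_bound (C := 1)
        (continuous_fejer.comp (continuous_const_mul ε)).aestronglyMeasurable
        (ae_of_all _ fun u => ?_)).2
      simp only [Function.comp]
      rw [Real.norm_of_nonneg (fejer_nonneg _)]
      exact fejer_le_one _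
    have hfinv : IsFiniteMeasure
        ((volume : Measure ℝ).withDensity fun u => ENNReal.ofReal (fejer (ε * u))) :=
      isFiniteMeasure_withDensity_ofReal (integrable_fejer.comp_mul_left' hε.ne').2
    have hfin1 : ∀ n, IsFiniteMeasure (ENNReal.ofReal (s n) •
        (lam n).withDensity fun u => ENNReal.ofReal (fejer (ε * u))) := by
      intro n
      have := hfinw (lam n) inferInstance
      exact Measure.smul_finite _ ENNReal.ofReal_ne_top
    have hfin2 : IsFiniteMeasure (ENNReal.ofReal p •
        (volume : Measure ℝ).withDensity fun u => ENNReal.ofReal (fejer (ε * u))) :=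
      Measure.smul_finite _ ENNReal.ofReal_ne_top
    have hcf : ∀ ζ, Tendsto (fun n => charFun (ENNReal.ofReal (s n) •
        (lam n).withDensity fun u => ENNReal.ofReal (fejer (ε * u))) ζ) atTop
        (𝓝 (charFun (ENNReal.ofReal p •
        (volume : Measure ℝ).withDensity fun u => ENNReal.ofReal (fejer (ε * u))) ζ)) := by
      intro ζ
      have hl := tendsto_integral_fejer_mul_exp h hs0 hs hε x ζ
      rw [charFun_smul_withDensity_fejer _ hp_nonneg, integral_fejer_dilated_mul_exp hε,
        show (p * (2 * Real.pi / ε * tent (ζ / ε)) : ℂ) = 1 / ε * (tent (ζ / ε) * fhat f x) by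
          rw [hfhat]; ring]
      refine hl.congr fun n => ?_
      rw [charFun_smul_withDensity_fejer _ (hs0 n).le]
      congr 1
      rw [integral_map (hφ n).aemeasurable]
      have := continuous_fejer
      exact Continuous.aestronglyMeasurable (by fun_prop)
    have hnull : (ENNReal.ofReal p • (volume : Measure ℝ).withDensity
        fun u => ENNReal.ofReal (fejer (ε * u))) (frontier B) = 0 := by
      rw [Measure.smul_apply, withDensity_absolutelyContinuous _ _ hB.volume_frontier, smul_zero]
    have := tendsto_measureReal_of_tendsto_charFun hcf hnull
    simp only [measureReal_ennreal_smul_apply, ENNReal.toReal_ofReal hp_nonneg] at this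
    refine this.congr fun n => ?_
    rw [ENNReal.toReal_ofReal (hs0 n).le]
  -- on the bounded set `B` the weight is uniformly close to `1` when `ε` is small
  have hclose : ∀ a : ℝ, a < 1 → ∃ ε : ℝ, 0 < ε ∧ ∀ u ∈ B, a ≤ fejer (ε * u) := by
    intro a ha
    have hev : ∀ᶠ v in 𝓝 (0 : ℝ), a < fejer v :=
      (continuous_fejer.tendsto 0).eventually (lt_mem_nhds (by rwa [fejer_zero]))
    obtain ⟨r, hr, hball⟩ := Metric.eventually_nhds_iff.1 hev
    obtain ⟨R, hR0, hR⟩ := hB.isBounded.exists_pos_norm_le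
    refine ⟨r / (2 * R), by positivity, fun u hu => (hball ?_).le⟩
    rw [Real.dist_0_eq_abs, abs_mul, abs_of_pos (by positivity)]
    calc r / (2 * R) * |u| ≤ r / (2 * R) * R := by
          gcongr
          exact hR u hu
      _ = r / 2 := by field_simp
      _ < r := by linarith
  refine tendsto_order.2 ⟨fun b hb => ?_, fun b hb => ?_⟩
  · -- choose `a < 1` with `b < a * (p * volume.real B)`
    have hcont : Tendsto (fun a : ℝ => a * (p * volume.real B)) (𝓝[<] 1)
        (𝓝 (1 * (p * volume.real B))) :=
      (tendsto_id.mono_left nhdsWithin_le_nhds).mul_const _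
    rw [one_mul] at hcont
    obtain ⟨a, hab, ha1, ha0⟩ := ((hcont.eventually (lt_mem_nhds hb)).and
      ((eventually_mem_nhdsWithin : ∀ᶠ a in 𝓝[<] (1 : ℝ), a ∈ Iio 1).and
        (nhdsWithin_le_nhds (lt_mem_nhds one_pos)))).exists
    obtain ⟨ε, hε, hεB⟩ := hclose a ha1
    have hv := (measureReal_withDensity_bounds hB.measurableSet hBfin (le_of_lt ha0) hεB
      fun u => fejer_le_one _).1
    have hlt : b < p * (volume.withDensity fun u => ENNReal.ofReal (fejer (ε * u))).real B := by
      refine hab.trans_le ?_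
      rw [mul_left_comm]
      exact mul_le_mul_of_nonneg_left hv hp_nonneg
    filter_upwards [(hker ε hε).eventually (lt_mem_nhds hlt)] with n hn
    refine hn.trans_le (mul_le_mul_of_nonneg_left ?_ (hs0 n).le)
    exact (measureReal_withDensity_bounds hB.measurableSet (measure_ne_top _ _) (le_of_lt ha0) hεB
      fun u => fejer_le_one _).2
  · -- choose `a < 1` with `p * volume.real B < a * b`
    have hcont : Tendsto (fun a : ℝ => a * b) (𝓝[<] 1) (𝓝 (1 * b)) :=
      (tendsto_id.mono_left nhdsWithin_le_nhds).mul_const _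
    rw [one_mul] at hcont
    obtain ⟨a, hab, ha1, ha0⟩ := ((hcont.eventually (lt_mem_nhds hb)).and
      ((eventually_mem_nhdsWithin : ∀ᶠ a in 𝓝[<] (1 : ℝ), a ∈ Iio 1).and
        (nhdsWithin_le_nhds (lt_mem_nhds one_pos)))).exists
    obtain ⟨ε, hε, hεB⟩ := hclose a ha1
    have hv := (measureReal_withDensity_bounds hB.measurableSet hBfin (le_of_lt ha0) hεB
      fun u => fejer_le_one _).2
    have hlt : p * (volume.withDensity fun u => ENNReal.ofReal (fejer (ε * u))).real B < a * b :=
      (mul_le_mul_of_nonneg_left hv hp_nonneg).trans_lt hab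
    filter_upwards [(hker ε hε).eventually (gt_mem_nhds hlt)] with n hn
    have h1 := (measureReal_withDensity_bounds (m := lam n) hB.measurableSet (measure_ne_top _ _)
      (le_of_lt ha0) hεB fun u => fejer_le_one _).1
    have h2 := mul_le_mul_of_nonneg_left h1 (hs0 n).le
    rw [mul_left_comm] at h2
    exact lt_of_mul_lt_mul_left (h2.trans_lt hn) (le_of_lt ha0)

end LocalLimit

/-! ### Integrability of a nonnegative Fourier transform -/

/-- A nonnegative Fourier transform of a bounded integrable function is integrable. -/
lemma integrable_fhat_of_nonneg {f : ℝ → ℂ} (hf : Integrable f) (hf1 : ∀ ξ, ‖f ξ‖ ≤ 1)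
    (hnn : ∀ x, 0 ≤ (fhat f x).re) (hre : ∀ x, fhat f x = ((fhat f x).re : ℂ)) :
    Integrable (fhat f) := by
  have hcont : Continuous fun x => (fhat f x).re :=
    Complex.continuous_re.comp (continuous_fhat hf)
  -- the integrals of `fhat f` against the kernels `fejer (ε ·)` are bounded
  have hbound : ∀ ε : ℝ, 0 < ε →
      ∫⁻ x, ENNReal.ofReal (fejer (ε * x) * (fhat f x).re) ≤ ENNReal.ofReal (2 * Real.pi) := by
    intro ε hε
    have hki : Integrable fun x => fejer (ε * x) := integrable_fejer.comp_mul_left' hε.ne'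
    have hbd : ∀ x, (fhat f x).re ≤ ∫ ξ, ‖f ξ‖ := by
      intro x
      refine (Complex.re_le_norm _).trans ((norm_integral_le_integral_norm _).trans_eq ?_)
      simp only [norm_mul, norm_exp_neg_I_mul, mul_one]
    have hint : Integrable fun x => fejer (ε * x) * (fhat f x).re := by
      refine (hki.mul_const (∫ ξ, ‖f ξ‖)).mono'
        (hki.aestronglyMeasurable.mul hcont.aestronglyMeasurable) (ae_of_all _ fun x => ?_)
      rw [Real.norm_of_nonneg (mul_nonneg (fejer_nonneg _) (hnn x))]
      exact mul_le_mul_of_nonneg_left (hbd x) (fejer_nonneg _)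
    rw [← ofReal_integral_eq_lintegral_ofReal hint
      (ae_of_all _ fun x => mul_nonneg (fejer_nonneg _) (hnn x))]
    refine ENNReal.ofReal_le_ofReal ?_
    have hF := integral_mul_integral_mul_exp (μ := volume) hf
      (hki.ofReal (𝕜 := ℂ))
    have hF2 : ((∫ x, fejer (ε * x) * (fhat f x).re : ℝ) : ℂ)
        = ∫ ξ : ℝ, f ξ * (2 * Real.pi / ε * tent (ξ / ε)) := by
      have hL : ∀ ξ : ℝ, ∫ y : ℝ, ((fejer (ε * y) : ℝ) : ℂ) * Complex.exp (Complex.I * y * ξ)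
          = 2 * Real.pi / ε * tent (ξ / ε) := by
        intro ξ
        rw [← integral_fejer_dilated_mul_exp hε]
        refine integral_congr_ae (ae_of_all _ fun y => ?_)
        simp only [mul_right_comm]
      have hR : ∀ y : ℝ, ∫ ξ : ℝ, f ξ * Complex.exp (Complex.I * y * ξ) = fhat f (-y) := by
        intro y
        refine integral_congr_ae (ae_of_all _ fun ξ => ?_)
        simp
      rw [← integral_complex_ofReal, ← integral_neg_eq_self]
      refine Eq.trans ?_ (hF.symm.trans ?_)
      · refine integral_congr_ae (ae_of_all _ fun y => ?_)
        simp only [hR, mul_neg, fejer_neg]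
        rw [Complex.ofReal_mul, ← hre (-y)]
        rfl
      · refine integral_congr_ae (ae_of_all _ fun ξ => ?_)
        simp only
        rw [← hL]
        rfl
    have hnorm : ‖((∫ x, fejer (ε * x) * (fhat f x).re : ℝ) : ℂ)‖
        ≤ ∫ ξ, 2 * Real.pi / ε * tent (ξ / ε) := by
      rw [hF2]
      refine norm_integral_le_of_norm_le ((integrable_tent.comp_div hε.ne').const_mul _)
        (ae_of_all _ fun ξ => ?_)
      have he : (2 * Real.pi / ε * tent (ξ / ε) : ℂ)
        = ((2 * Real.pi / ε * tent (ξ / ε) : ℝ) : ℂ) := by push_cast; rfl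
      have hnn' : 0 ≤ 2 * Real.pi / ε * tent (ξ / ε) :=
        mul_nonneg (by positivity) (tent_nonneg _)
      rw [norm_mul, he, Complex.norm_real, Real.norm_of_nonneg hnn']
      exact mul_le_of_le_one_left hnn' (hf1 ξ)
    have htent : ∫ v, tent v = 1 := by
      have := integral_tent_mul_exp 0
      simp only [Complex.ofReal_zero, mul_zero, zero_mul, Complex.exp_zero, mul_one, fejer_zero,
        integral_complex_ofReal] at this
      exact_mod_cast this
    rw [integral_const_mul, Measure.integral_comp_div, htent, abs_of_pos hε, Complex.norm_real]
      at hnorm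
    refine (le_abs_self _).trans (hnorm.trans_eq ?_)
    simp only [smul_eq_mul]
    field_simp
  have hfatou := lintegral_liminf_le (μ := volume) (u := atTop)
    (f := fun (n : ℕ) x => ENNReal.ofReal (fejer (1 / ((n : ℝ) + 1) * x) * (fhat f x).re)) (by
      intro n
      have := continuous_fejer
      exact ENNReal.measurable_ofReal.comp (Continuous.measurable (by fun_prop)))
  have hlim : ∀ x, liminf (fun n : ℕ =>
      ENNReal.ofReal (fejer (1 / ((n : ℝ) + 1) * x) * (fhat f x).re)) atTop
      = ENNReal.ofReal (fhat f x).re := by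
    intro x
    refine Tendsto.liminf_eq (ENNReal.tendsto_ofReal ?_)
    have h1 : Tendsto (fun n : ℕ => 1 / ((n : ℝ) + 1) * x) atTop (𝓝 (0 * x)) :=
      tendsto_one_div_add_atTop_nhds_zero_nat.mul_const x
    rw [zero_mul] at h1
    have h2 := ((continuous_fejer.tendsto _).comp h1).mul_const (fhat f x).re
    rwa [fejer_zero, one_mul] at h2
  simp_rw [hlim] at hfatou
  have hfin : ∫⁻ x, ENNReal.ofReal (fhat f x).re < ∞ := by
    refine (hfatou.trans (liminf_le_of_frequently_le' (x := ENNReal.ofReal (2 * Real.pi)) ?_)).trans_lt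
      ENNReal.ofReal_lt_top
    exact Frequently.of_forall fun n => hbound _ (by positivity)
  have hI : Integrable fun x => (fhat f x).re :=
    ⟨hcont.aestronglyMeasurable, (hasFiniteIntegral_iff_ofReal (ae_of_all _ hnn)).2 hfin⟩
  exact hI.ofReal.congr (ae_of_all _ fun x => (hre x).symm)

/-! ### The exponent of a stable law -/

lemma re_stableExponent (c α β ξ : ℝ) : (stableExponent c α β ξ).re = -(|c * ξ| ^ α) := by
  simp [stableExponent]

lemma norm_exp_stableExponent (c α β ξ : ℝ) :
    ‖Complex.exp (stableExponent c α β ξ)‖ = Real.exp (-(|c * ξ| ^ α)) := by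
  rw [Complex.norm_exp, re_stableExponent]

lemma stableExponent_zero {α : ℝ} (c β : ℝ) (hα : 0 < α) : stableExponent c α β 0 = 0 := by
  simp [stableExponent, Real.zero_rpow hα.ne']

/-- The function `ξ ↦ |cξ|^α sgn ξ` is continuous although `sgn` is not. -/
lemma continuous_abs_rpow_mul_sign (c : ℝ) {α : ℝ} (hα : 0 < α) :
    Continuous fun ξ : ℝ => |c * ξ| ^ α * Real.sign ξ := by
  have hpow : Continuous fun ξ : ℝ => |c * ξ| ^ α :=
    (continuous_const_mul c).abs.rpow_const fun _ => Or.inr hα.le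
  refine continuous_iff_continuousAt.2 fun ξ => ?_
  rcases lt_trichotomy ξ 0 with h | rfl | h
  · refine (hpow.continuousAt.mul_const (-1)).congr ?_
    filter_upwards [gt_mem_nhds h] with y hy
    rw [Real.sign_of_neg hy]
  · rw [ContinuousAt, Real.sign_zero, mul_zero]
    have h0 : Tendsto (fun ξ : ℝ => |c * ξ| ^ α) (𝓝 0) (𝓝 0) := by
      simpa [Real.zero_rpow hα.ne'] using hpow.tendsto 0
    refine squeeze_zero_norm (fun y => ?_) h0
    rw [norm_mul, Real.norm_of_nonneg (by positivity)]
    refine mul_le_of_le_one_right (by positivity) ?_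
    rcases Real.sign_apply_eq y with h | h | h <;> simp [h]
  · refine (hpow.continuousAt.mul_const 1).congr ?_
    filter_upwards [lt_mem_nhds h] with y hy
    rw [Real.sign_of_pos hy]

lemma continuous_stableExponent {c α : ℝ} (β : ℝ) (hc : 0 < c) (hα : 0 < α) :
    Continuous (stableExponent c α β) := by
  have hpow : Continuous fun ξ : ℝ => |c * ξ| ^ α :=
    (continuous_const_mul c).abs.rpow_const fun _ => Or.inr hα.le
  have hI : Continuous fun ξ : ℝ => |c * ξ| ^ α * (β * stableH α ξ * Real.sign ξ) := by
    by_cases h1 : α = 1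
    · have he : (fun ξ : ℝ => |c * ξ| ^ α * (β * stableH α ξ * Real.sign ξ))
          = fun ξ : ℝ => -(c * β * (2 / Real.pi)) * (ξ * Real.log ξ) := by
        funext ξ
        have hs : |ξ| * Real.sign ξ = ξ := by
          rcases lt_trichotomy ξ 0 with h | rfl | h
          · rw [Real.sign_of_neg h, abs_of_neg h]; ring
          · simp
          · rw [Real.sign_of_pos h, abs_of_pos h]; ring
        rw [stableH, if_pos h1, h1, Real.rpow_one, abs_mul, abs_of_pos hc, Real.log_abs]
        linear_combination -(c * β * (2 / Real.pi) * Real.log ξ) * hs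
      rw [he]
      exact Real.continuous_mul_log.const_mul _
    · have he : (fun ξ : ℝ => |c * ξ| ^ α * (β * stableH α ξ * Real.sign ξ))
          = fun ξ : ℝ => β * Real.tan (Real.pi * α / 2) * (|c * ξ| ^ α * Real.sign ξ) := by
        funext ξ
        rw [stableH, if_neg h1]
        ring
      rw [he]
      exact (continuous_abs_rpow_mul_sign c hα).const_mul _
  have he : stableExponent c α β = fun ξ : ℝ => -((|c * ξ| ^ α : ℝ) : ℂ)
      + Complex.I * ((|c * ξ| ^ α * (β * stableH α ξ * Real.sign ξ) : ℝ) : ℂ) := by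
    funext ξ
    rw [stableExponent]
    push_cast
    ring
  rw [he]
  exact (Complex.continuous_ofReal.comp hpow).neg.add
    (continuous_const.mul (Complex.continuous_ofReal.comp hI))

/-- Moments of `exp (-b |ξ|^α)`: the integral is a nonzero value of the Gamma function, and would
vanish by convention if the function were not integrable. -/
lemma integrable_abs_rpow_mul_exp_neg {α ν b : ℝ} (hα : 0 < α) (hν : 0 ≤ ν) (hb : 0 < b) :
    Integrable fun ξ : ℝ => |ξ| ^ ν * Real.exp (-b * |ξ| ^ α) := by
  refine not_imp_comm.1 integral_undef ?_
  rw [integral_comp_abs (f := fun x => x ^ ν * Real.exp (-b * x ^ α)),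
    integral_rpow_mul_exp_neg_mul_rpow hα (by linarith) hb]
  have : 0 < Real.Gamma ((ν + 1) / α) := Real.Gamma_pos_of_pos (by positivity)
  positivity

lemma integrable_exp_stableExponent {c α : ℝ} (β : ℝ) (hc : 0 < c) (hα : 0 < α) :
    Integrable fun ξ => Complex.exp (stableExponent c α β ξ) := by
  refine (integrable_abs_rpow_mul_exp_neg hα le_rfl (b := c ^ α) (by positivity)).mono'
    (Complex.continuous_exp.comp (continuous_stableExponent β hc hα)).aestronglyMeasurable
    (ae_of_all _ fun ξ => ?_)
  rw [norm_exp_stableExponent, abs_mul, abs_of_pos hc, Real.mul_rpow hc.le (abs_nonneg _)]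
  simp

/-- The drift by which `η` fails to be homogeneous; it is nonzero only for `α = 1`. -/
def stableDrift (c α β t : ℝ) : ℝ := if α = 1 then 2 * c * β / Real.pi * Real.log t else 0

/-- Stability of the law in terms of the exponent. -/
lemma mul_stableExponent_div {c α β t : ℝ} (hc : 0 < c) (hα : 0 < α) (ht : 0 < t) (ξ : ℝ) :
    t * stableExponent c α β (ξ / t ^ (1 / α))
      = stableExponent c α β ξ + Complex.I * ξ * stableDrift c α β t := by
  rcases eq_or_ne ξ 0 with rfl | hξ
  · simp [stableExponent_zero c β hα]
  have ha : 0 < t ^ (1 / α) := Real.rpow_pos_of_pos ht _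
  have hsign : Real.sign (ξ / t ^ (1 / α)) = Real.sign ξ := by
    rcases lt_or_gt_of_ne hξ with h | h
    · rw [Real.sign_of_neg h, Real.sign_of_neg (div_neg_of_neg_of_pos h ha)]
    · rw [Real.sign_of_pos h, Real.sign_of_pos (div_pos h ha)]
  have habs : t * |c * (ξ / t ^ (1 / α))| ^ α = |c * ξ| ^ α := by
    rw [← mul_div_assoc, abs_div, abs_of_pos ha, Real.div_rpow (abs_nonneg _) ha.le,
      ← Real.rpow_mul ht.le, one_div_mul_cancel hα.ne', Real.rpow_one]
    field_simp
  have habs' : (t : ℂ) * ((|c * (ξ / t ^ (1 / α))| ^ α : ℝ) : ℂ) = ((|c * ξ| ^ α : ℝ) : ℂ) := by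
    exact_mod_cast habs
  by_cases h1 : α = 1
  · have hH : |c * ξ| ^ α * (β * stableH α (ξ / t ^ (1 / α)) * Real.sign ξ)
        = |c * ξ| ^ α * (β * stableH α ξ * Real.sign ξ) + ξ * stableDrift c α β t := by
      have hs : |ξ| * Real.sign ξ = ξ := by
        rcases lt_or_gt_of_ne hξ with h | h
        · rw [Real.sign_of_neg h, abs_of_neg h]; ring
        · rw [Real.sign_of_pos h, abs_of_pos h]; ring
      subst h1
      simp only [stableH, stableDrift, if_true, Real.rpow_one, div_one]
      rw [abs_div, abs_of_pos ht, Real.log_div (abs_ne_zero.2 hξ) ht.ne', abs_mul, abs_of_pos hc]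
      linear_combination (2 / Real.pi * c * β * Real.log t) * hs
    have hH' : ((|c * ξ| ^ α : ℝ) : ℂ)
        * ((β * stableH α (ξ / t ^ (1 / α)) * Real.sign ξ : ℝ) : ℂ)
        = ((|c * ξ| ^ α : ℝ) : ℂ) * ((β * stableH α ξ * Real.sign ξ : ℝ) : ℂ)
          + ξ * (stableDrift c α β t : ℂ) := by exact_mod_cast hH
    rw [stableExponent, stableExponent, hsign]
    linear_combination (-(1 - Complex.I
      * ((β * stableH α (ξ / t ^ (1 / α)) * Real.sign ξ : ℝ) : ℂ))) * habs' + Complex.I * hH'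
  · have hH : stableH α (ξ / t ^ (1 / α)) = stableH α ξ := by simp [stableH, h1]
    rw [stableExponent, stableExponent, hsign, hH, stableDrift, if_neg h1, ← habs']
    push_cast
    ring

lemma renormalise_eq {Ω : Type*} (X : Ω → ℝ) (c α β t : ℝ) (w : Ω) :
    renormalise X c α β t w = X w / t ^ (1 / α) - stableDrift c α β t := by
  by_cases h1 : α = 1 <;> simp [renormalise, stableDrift, h1]

/-- The characteristic function of the renormalised variable is that of the stable law times the
rescaled residue. -/
lemma charFun_map_renormalise {Ω : Type*} [MeasurableSpace Ω] {P : Measure Ω} {X : Ω → ℝ}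
    (hX : AEMeasurable X P) {c α β t : ℝ} (hc : 0 < c) (hα : 0 < α) (ht : 0 < t) (ξ : ℝ) :
    charFun (P.map (renormalise X c α β t)) ξ
      = residue P X c α β t (ξ / t ^ (1 / α)) * Complex.exp (stableExponent c α β ξ) := by
  have ha : (t ^ (1 / α)) ≠ 0 := (Real.rpow_pos_of_pos ht _).ne'
  have hY : renormalise X c α β t = fun w => X w / t ^ (1 / α) - stableDrift c α β t :=
    funext (renormalise_eq X c α β t)
  rw [charFun_apply_real, hY, integral_map ((hX.div_const _).sub_const _)
    (Continuous.aestronglyMeasurable (by fun_prop)), residue, mul_assoc, ← Complex.exp_add,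
    mul_stableExponent_div hc hα ht, ← integral_mul_const]
  refine integral_congr_ae (ae_of_all _ fun w => ?_)
  simp only
  rw [← Complex.exp_add]
  congr 1
  push_cast
  ring

/-! ### Consequences of a zone of control -/

section Zone

variable {Ω : ℕ → Type*} [∀ n, MeasurableSpace (Ω n)] {P : ∀ n, Measure (Ω n)}
  {X : ∀ n, Ω n → ℝ} {c α β : ℝ} {t : ℕ → ℝ} {K γ ν ω : ℝ}

/-- On the zone of control, the exponential growth of the residue is absorbed by half of the
exponent of the stable law, once `T` is large. The bound on `K` serves for `α < ω`, and the lower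
bound `2 K₂ / c^α` on `T` for `ω = α`. -/
lemma exp_rescaled_le {K₂ T ξ : ℝ} (hc : 0 < c) (hα : 0 < α) (hK : 0 < K) (hK₂ : 0 < K₂)
    (hαω : α ≤ ω) (hγ : α < ω → γ ≤ 1 / (ω - α))
    (hKle : α < ω → K ≤ (c ^ α / (2 * K₂)) ^ (1 / (ω - α))) (hT1 : 1 ≤ T)
    (hT : 2 * K₂ / c ^ α ≤ T) (hξ : |ξ| ≤ K * T ^ (γ + 1 / α)) :
    K₂ * |ξ / T ^ (1 / α)| ^ ω ≤ c ^ α / 2 * |ξ| ^ α := by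
  have hT0 : 0 < T := by linarith
  have ha : 0 < T ^ (1 / α) := Real.rpow_pos_of_pos hT0 _
  have hcα : 0 < c ^ α := Real.rpow_pos_of_pos hc _
  rcases eq_or_ne ξ 0 with rfl | hξ0
  · simp [Real.zero_rpow hα.ne', Real.zero_rpow (hα.trans_le hαω).ne']
  have hξp : 0 < |ξ| := abs_pos.2 hξ0
  rw [abs_div, abs_of_pos ha]
  set u : ℝ := |ξ| / T ^ (1 / α) with hu
  have hu0 : 0 < u := div_pos hξp ha
  have huK : u ≤ K * T ^ γ := by
    rw [hu, div_le_iff₀ ha, mul_assoc, ← Real.rpow_add hT0]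
    exact hξ
  have hξα : |ξ| ^ α = T * u ^ α := by
    rw [hu, Real.div_rpow hξp.le ha.le, ← Real.rpow_mul hT0.le, one_div_mul_cancel hα.ne',
      Real.rpow_one]
    field_simp
  rw [hξα]
  have huα : 0 < u ^ α := Real.rpow_pos_of_pos hu0 _
  suffices h : K₂ * u ^ (ω - α) ≤ c ^ α / 2 * T by
    calc K₂ * u ^ ω = K₂ * u ^ (ω - α) * u ^ α := by
          rw [mul_assoc, ← Real.rpow_add hu0, sub_add_cancel]
      _ ≤ c ^ α / 2 * T * u ^ α := by gcongr
      _ = c ^ α / 2 * (T * u ^ α) := by ring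
  rcases hαω.eq_or_lt with h | h
  · rw [h, sub_self, Real.rpow_zero, mul_one, ← h]
    rw [div_le_iff₀ hcα] at hT
    linarith
  · have hd : 0 < ω - α := sub_pos.2 h
    have h1 : K ^ (ω - α) ≤ c ^ α / (2 * K₂) := by
      calc K ^ (ω - α) ≤ ((c ^ α / (2 * K₂)) ^ (1 / (ω - α))) ^ (ω - α) :=
            Real.rpow_le_rpow hK.le (hKle h) hd.le
        _ = c ^ α / (2 * K₂) := by
            rw [← Real.rpow_mul (by positivity), one_div_mul_cancel hd.ne', Real.rpow_one]
    have h2 : (T ^ γ) ^ (ω - α) ≤ T := by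
      rw [← Real.rpow_mul hT0.le]
      calc T ^ (γ * (ω - α)) ≤ T ^ (1 : ℝ) := by
            refine Real.rpow_le_rpow_of_exponent_le hT1 ?_
            have := mul_le_mul_of_nonneg_right (hγ h) hd.le
            rwa [one_div_mul_cancel hd.ne'] at this
        _ = T := Real.rpow_one T
    calc K₂ * u ^ (ω - α) ≤ K₂ * (K * T ^ γ) ^ (ω - α) := by gcongr
      _ = K₂ * (K ^ (ω - α) * (T ^ γ) ^ (ω - α)) := by
          rw [Real.mul_rpow hK.le (by positivity)]
      _ ≤ K₂ * (c ^ α / (2 * K₂) * T) := by gcongr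
      _ = c ^ α / 2 * T := by field_simp

/-- On the rescaled zone of control, the distance from the characteristic functions to that of the
stable law is at most an integrable function times a factor that tends to `0`. -/
lemma HasZoneOfControl.charFun_bound (hX : ∀ n, AEMeasurable (X n) (P n)) (hc : 0 < c)
    (hα : 0 < α) (ht_pos : ∀ n, 0 < t n) (ht : Tendsto t atTop atTop)
    (hzone : HasZoneOfControl P X t c α β K γ ν ω) :
    ∃ K₁ : ℝ, 0 < K₁ ∧ ∀ᶠ n in atTop, ∀ ξ : ℝ, |ξ| ≤ K * t n ^ (γ + 1 / α) →
      ‖charFun ((P n).map (renormalise (X n) c α β (t n))) ξ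
        - Complex.exp (stableExponent c α β ξ)‖
      ≤ K₁ * (|ξ| ^ ν * Real.exp (-(c ^ α / 2) * |ξ| ^ α)) * (t n ^ (1 / α))⁻¹ ^ ν := by
  obtain ⟨hν, hω, hK, hαω, hγ1, hγ2, K₁, K₂, hK₁, hK₂, hKle, hres⟩ := hzone
  refine ⟨K₁, hK₁, ?_⟩
  filter_upwards [ht.eventually_ge_atTop 1, ht.eventually_ge_atTop (2 * K₂ / c ^ α)]
    with n hn1 hn2 ξ hξ
  have hT0 := ht_pos n
  have ha : 0 < t n ^ (1 / α) := Real.rpow_pos_of_pos hT0 _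
  have hmem : ξ / t n ^ (1 / α) ∈ Icc (-(K * t n ^ γ)) (K * t n ^ γ) := by
    refine abs_le.1 ?_
    rw [abs_div, abs_of_pos ha, div_le_iff₀ ha, mul_assoc, ← Real.rpow_add hT0]
    exact hξ
  have h1 := hres n _ hmem
  have h2 := exp_rescaled_le hc hα hK hK₂ hαω hγ2 hKle hn1 hn2 hξ
  rw [charFun_map_renormalise (hX n) hc hα hT0, ← sub_one_mul, norm_mul, norm_exp_stableExponent]
  calc _ ≤ K₁ * |ξ / t n ^ (1 / α)| ^ ν * Real.exp (c ^ α / 2 * |ξ| ^ α)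
        * Real.exp (-(|c * ξ| ^ α)) := by
        refine mul_le_mul_of_nonneg_right (h1.trans ?_) (Real.exp_pos _).le
        gcongr
    _ = _ := by
        have he : Real.exp (c ^ α / 2 * |ξ| ^ α) * Real.exp (-(|c * ξ| ^ α))
            = Real.exp (-(c ^ α / 2) * |ξ| ^ α) := by
          rw [← Real.exp_add, abs_mul, abs_of_pos hc, Real.mul_rpow hc.le (abs_nonneg _)]
          congr 1
          ring
        rw [mul_assoc, he, abs_div, abs_of_pos ha, div_eq_mul_inv,
          Real.mul_rpow (abs_nonneg _) (inv_nonneg.2 ha.le)]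
        ring

/-- A zone of control controls the characteristic functions at all scales `1 / (t n)^δ` with
`δ < γ + 1 / α`. -/
lemma HasZoneOfControl.charFunControl (hX : ∀ n, AEMeasurable (X n) (P n)) (hc : 0 < c)
    (hα : 0 < α) (ht_pos : ∀ n, 0 < t n) (ht : Tendsto t atTop atTop)
    (hzone : HasZoneOfControl P X t c α β K γ ν ω) {δ : ℝ} (hδ : δ < γ + 1 / α) :
    CharFunControl (fun n => (P n).map (renormalise (X n) c α β (t n))) (fun n => t n ^ δ)
      (fun ξ => Complex.exp (stableExponent c α β ξ)) := by
  obtain ⟨K₁, hK₁, hbd⟩ := hzone.charFun_bound hX hc hα ht_pos ht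
  obtain ⟨hν, hω, hK, hαω, hγ1, -⟩ := hzone
  have hpos : 0 < γ + 1 / α := by linarith
  constructor
  · intro ξ
    have hin : ∀ᶠ n in atTop, |ξ| ≤ K * t n ^ (γ + 1 / α) :=
      (((tendsto_rpow_atTop hpos).comp ht).const_mul_atTop hK).eventually_ge_atTop _
    have hinv : Tendsto (fun n => (t n ^ (1 / α))⁻¹ ^ ν) atTop (𝓝 0) := by
      have h1 : Tendsto (fun n => (t n ^ (1 / α))⁻¹) atTop (𝓝 0) :=
        tendsto_inv_atTop_zero.comp ((tendsto_rpow_atTop (by positivity)).comp ht)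
      have := ((Real.continuous_rpow_const hν.le).tendsto 0).comp h1
      rwa [Real.zero_rpow hν.ne'] at this
    have h0 := hinv.const_mul (K₁ * (|ξ| ^ ν * Real.exp (-(c ^ α / 2) * |ξ| ^ α)))
    rw [mul_zero] at h0
    rw [tendsto_iff_norm_sub_tendsto_zero]
    refine squeeze_zero' (Eventually.of_forall fun _ => norm_nonneg _) ?_ h0
    filter_upwards [hbd, hin] with n hn hξ using hn ξ hξ
  · refine ⟨fun ξ => ‖Complex.exp (stableExponent c α β ξ)‖
      + K₁ * (|ξ| ^ ν * Real.exp (-(c ^ α / 2) * |ξ| ^ α)),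
      (integrable_exp_stableExponent β hc hα).norm.add
        ((integrable_abs_rpow_mul_exp_neg hα hν.le (by positivity)).const_mul K₁), fun C => ?_⟩
    have hC : ∀ᶠ n in atTop, C ≤ K * t n ^ (γ + 1 / α - δ) :=
      (((tendsto_rpow_atTop (sub_pos.2 hδ)).comp ht).const_mul_atTop hK).eventually_ge_atTop _
    filter_upwards [hbd, hC, ht.eventually_ge_atTop 1] with n hn hCn hn1 ξ hξ
    have hT0 := ht_pos n
    have hin : |ξ| ≤ K * t n ^ (γ + 1 / α) := by
      refine hξ.trans ((mul_le_mul_of_nonneg_right hCn (by positivity)).trans_eq ?_)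
      rw [mul_assoc, ← Real.rpow_add hT0, sub_add_cancel]
    have h1 := hn ξ hin
    have hle1 : (t n ^ (1 / α))⁻¹ ^ ν ≤ 1 :=
      Real.rpow_le_one (by positivity)
        (inv_le_one_of_one_le₀ (Real.one_le_rpow hn1 (by positivity))) hν.le
    have h2 := h1.trans (mul_le_of_le_one_right (by positivity) hle1)
    have h3 := norm_le_norm_add_norm_sub' (charFun ((P n).map (renormalise (X n) c α β (t n))) ξ)
      (Complex.exp (stableExponent c α β ξ))
    linarith

end Zone

/-! ### The stable law and its density -/

lemma stableDensity_eq (c α β y : ℝ) :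
    stableDensity c α β y
      = (fhat (fun ξ => Complex.exp (stableExponent c α β ξ)) y).re / (2 * Real.pi) := by
  rw [stableDensity, fhat]
  ring

/-- The stable law exists and has density `stableDensity`, as soon as the inverse Fourier transform
of `exp ∘ stableExponent` is real and nonnegative. -/
lemma exists_isStableLaw {c α β : ℝ} (hc : 0 < c) (hα : 0 < α)
    (hnn : ∀ x, 0 ≤ (fhat (fun ξ => Complex.exp (stableExponent c α β ξ)) x).re)
    (hre : ∀ x, fhat (fun ξ => Complex.exp (stableExponent c α β ξ)) x
      = ((fhat (fun ξ => Complex.exp (stableExponent c α β ξ)) x).re : ℂ)) :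
    ∃ φ : Measure ℝ, IsStableLaw c α β φ ∧ IsContinuousDensity (stableDensity c α β) φ := by
  set f : ℝ → ℂ := fun ξ => Complex.exp (stableExponent c α β ξ) with hf
  have hfi : Integrable f := integrable_exp_stableExponent β hc hα
  have hfc : Continuous f := Complex.continuous_exp.comp (continuous_stableExponent β hc hα)
  have hf1 : ∀ ξ, ‖f ξ‖ ≤ 1 := fun ξ => by
    rw [hf, norm_exp_stableExponent]
    exact Real.exp_le_one_iff.2 (neg_nonpos.2 (by positivity))
  have hFi := integrable_fhat_of_nonneg hfi hf1 hnn hre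
  have hpc : Continuous (stableDensity c α β) := by
    rw [funext (stableDensity_eq c α β)]
    exact (Complex.continuous_re.comp (continuous_fhat hfi)).div_const _
  have hp0 : ∀ x, 0 ≤ stableDensity c α β x := fun x => by
    rw [stableDensity_eq]
    exact div_nonneg (hnn x) (by positivity)
  have hpi : (Real.pi : ℂ) ≠ 0 := by exact_mod_cast Real.pi_ne_zero
  have hpf : ∀ x, (stableDensity c α β x : ℂ) = fhat f x / (2 * Real.pi) := fun x => by
    rw [stableDensity_eq, hre x]
    push_cast
    rfl
  have hfourier : ∀ ξ : ℝ, ∫ x : ℝ, (stableDensity c α β x : ℂ) * Complex.exp (Complex.I * ξ * x)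
      = f ξ := by
    intro ξ
    have h := integral_fhat_mul_exp hfc hfi hFi ξ
    simp_rw [hpf, div_mul_eq_mul_div]
    rw [integral_div, h]
    field_simp
  have hpi' : Integrable (stableDensity c α β) := by
    rw [funext (stableDensity_eq c α β)]
    exact hFi.re.div_const _
  have hmass : ∫ x, stableDensity c α β x = 1 := by
    have h := hfourier 0
    simp only [Complex.ofReal_zero, mul_zero, zero_mul, Complex.exp_zero, mul_one, hf,
      stableExponent_zero c β hα, integral_complex_ofReal] at h
    exact_mod_cast h
  refine ⟨volume.withDensity fun x => ENNReal.ofReal (stableDensity c α β x), ⟨⟨?_⟩, fun ξ => ?_⟩,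
    ⟨hpc, hp0, rfl⟩⟩
  · rw [withDensity_apply _ MeasurableSet.univ, setLIntegral_univ,
      ← ofReal_integral_eq_lintegral_ofReal hpi' (ae_of_all _ hp0), hmass, ENNReal.ofReal_one]
  · rw [integral_withDensity_eq_integral_toReal_smul
      hpc.measurable.ennreal_ofReal (ae_of_all _ fun _ => ENNReal.ofReal_lt_top)]
    refine Eq.trans ?_ (hfourier ξ)
    refine integral_congr_ae (ae_of_all _ fun x => ?_)
    simp only [ENNReal.toReal_ofReal (hp0 x), Complex.real_smul]

end ModStable

end

theorem theorem3p2
    {Ω : ℕ → Type*} [∀ n, MeasurableSpace (Ω n)] (P : ∀ n, Measure (Ω n))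
    [∀ n, IsProbabilityMeasure (P n)] (X : ∀ n, Ω n → ℝ) (hX : ∀ n, AEMeasurable (X n) (P n))
    (c α β : ℝ) (hc : 0 < c) (hα : α ∈ Ioc (0 : ℝ) 2) (hβ : β ∈ Icc (-1 : ℝ) 1)
    (t : ℕ → ℝ) (ht_pos : ∀ n, 0 < t n) (ht : Tendsto t atTop atTop)
    (K γ ν ω : ℝ) (hzone : ModStable.HasZoneOfControl P X t c α β K γ ν ω) :
    (∃ φ : Measure ℝ, ModStable.IsStableLaw c α β φ ∧
      ModStable.IsContinuousDensity (ModStable.stableDensity c α β) φ) ∧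
    ∀ δ : ℝ, 0 < δ → δ < γ + 1 / α → ∀ x : ℝ, ∀ B : Set ℝ,
      ModStable.IsJordanMeasurable B → 0 < volume B →
      Tendsto
        (fun n => t n ^ δ *
          (P n).real {w | ModStable.renormalise (X n) c α β (t n) w - x ∈ (1 / t n ^ δ) • B})
        atTop (𝓝 (ModStable.stableDensity c α β x * volume.real B)) := by
  have hY : ∀ n, AEMeasurable (ModStable.renormalise (X n) c α β (t n)) (P n) := fun n => by
    rw [funext (ModStable.renormalise_eq (X n) c α β (t n))]
    exact ((hX n).div_const _).sub_const _
  have hprob : ∀ n, IsProbabilityMeasure ((P n).map (ModStable.renormalise (X n) c α β (t n))) :=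
    fun n => Measure.isProbabilityMeasure_map (hY n)
  have hs0 : ∀ (δ : ℝ) (n : ℕ), 0 < t n ^ δ := fun δ n => Real.rpow_pos_of_pos (ht_pos n) δ
  have hs : ∀ δ : ℝ, 0 < δ → Tendsto (fun n => t n ^ δ) atTop atTop := fun δ hδ =>
    (tendsto_rpow_atTop hδ).comp ht
  have hctl := fun δ (hδ : δ < γ + 1 / α) => hzone.charFunControl hX hc hα.1 ht_pos ht hδ
  refine ⟨?_, fun δ hδ0 hδ x B hB _ => ?_⟩
  · have hpos : 0 < γ + 1 / α := by
      obtain ⟨-, -, -, -, h, -⟩ := hzone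
      linarith
    have h := fun x => (hctl ((γ + 1 / α) / 2) (by linarith)).fhat_nonneg (hs0 _)
      (hs _ (by linarith)) x
    exact ModStable.exists_isStableLaw hc hα.1 (fun x => (h x).1) fun x => (h x).2
  · rw [ModStable.stableDensity_eq]
    refine ((hctl δ hδ).tendsto_measureReal (hs0 δ) (hs δ hδ0) x hB).congr fun n => ?_
    have hset : {w | ModStable.renormalise (X n) c α β (t n) w - x ∈ (1 / t n ^ δ) • B}
        = ModStable.renormalise (X n) c α β (t n) ⁻¹' {y | t n ^ δ * (y - x) ∈ B} := by
      ext w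
      simp only [mem_ofPred_eq, mem_preimage]
      rw [one_div, mem_inv_smul_set_iff₀ (hs0 δ n).ne', smul_eq_mul]
    have hmeas : MeasurableSet {y | t n ^ δ * (y - x) ∈ B} := by
      have h : Measurable fun y : ℝ => t n ^ δ * (y - x) := by fun_prop
      exact h hB.measurableSet
    rw [hset, measureReal_def, measureReal_def, Measure.map_apply_of_aemeasurable (hY n) hmeas]
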